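/- Let $k$ be a field and let $A$ be a Frobenius $k$-algebra, i.e. a finite-dimensional associative unital $k$-algebra that has a nonsingular associative $k$-bilinear form $\beta\colon A\times A\to k$ (associative: $\beta(ab,c)=\beta(a,bc)$). Assume that $k$ is a splitting field for $A$, i.e. $\operatorname{End}_A(V)=k$ for every irreducible left $A$-module $V$. Fix any such form $\beta$, and let $x_1,\dots,x_n$ and $y_1,\dots,y_n$ be dual bases for $\beta$, i.e. elements of $A$ with $a=\sum_i\beta(a,y_i)x_i$ for all $a\in A$. The Higman trace is the $k$-linear map $\tau\colon A\to A$, $\tau(a)=\sum_i x_i a y_i$; it depends only on $\beta$, not on the dual bases. For a $k$-algebra $R$ put $T(R)=R/[R,R]$, where $[R,R]$ is spanned by all $xy-yx$ with $x,y\in R$. The map $\tau$ factors through the canonical map $A\twoheadrightarrow T(A/\operatorname{rad}A)$, where $\operatorname{rad}A$ is the Jacobson radical; let $\tilde\tau\colon T(A/\operatorname{rad}A)\to A$ be the induced map. Let $K_0(A)$ and $G_0(A)$ be the Grothendieck groups of the finitely generated projective left $A$-modules and of all finitely generated left $A$-modules, respectively (with a relation $[V]=[U]+[W]$ for each short exact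 sequence $0\to U\to V\to W\to 0$), and let $c\colon K_0(A)\to G_0(A)$, $[P]\mapsto[P]$, be the Cartan map. Let $V_1,\dots,V_r$ represent the isomorphism classes of irreducible left $A$-modules, and let $P_j$ be a projective cover of $V_j$. The Cartan matrix $C\in M_r(\mathbb Z)$ is the matrix of $c$ with respect to the $\mathbb Z$-bases $[P_1],\dots,[P_r]$ of $K_0(A)$ and $[V_1],\dots,[V_r]$ of $G_0(A)$. Then: (a) The rank of the $k$-linear map $c\otimes 1_k\colon K_0(A)\otimes_{\mathbb Z}k\to G_0(A)\otimes_{\mathbb Z}k$ equals the rank of $\tau$. (b) If $A\neq 0$, then the following are equivalent: (i) $A$ is semisimple; (ii) $C=\operatorname{Id}$ and $\tilde\tau^{-1}(A^\times\cup\{0\})\neq\{0\}$; (iii) $\operatorname{char}k$ does not divide $\det C$ (for $\operatorname{char}k=0$: $\det C\neq 0$) and $\tilde\tau^{-1}(A^\times\cup\{0\})\neq\{0\}$. -/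

import Mathlib

universe u v w

namespace FrobeniusCartan

section Trace

variable (k : Type v) (R : Type u) [Field k] [Ring R] [Algebra k R]

/-- `[R, R]`, spanned by all Lie commutators `x * y - y * x`. -/
def commutatorSubmodule : Submodule k R :=
  Submodule.span k {z | ∃ x y : R, z = x * y - y * x}

/-- `T(R) = R / [R, R]`. -/
abbrev TraceSpace : Type u := R ⧸ commutatorSubmodule k R

variable {R} in
/-- The canonical map `R → T(R)`. -/
abbrev traceClass : R →ₗ[k] TraceSpace k R := (commutatorSubmodule k R).mkQ

end Trace

section Frobenius

variable (k : Type v) (A : Type u) [Field k] [Ring A] [Algebra k A]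

/-- A nonsingular associative `k`-bilinear form `β : A × A → k`. A finite-dimensional `k`-algebra
is Frobenius if and only if it has such a form. -/
structure FrobeniusForm where
  form : LinearMap.BilinForm k A
  assoc : ∀ a b c : A, form (a * b) c = form a (b * c)
  nondegenerate : form.Nondegenerate

variable {k A} [Module.Finite k A]

namespace FrobeniusForm

variable (β : FrobeniusForm k A)

/-- The second family `y` of a pair of dual bases for `β`. -/
noncomputable def dualY (i : Fin (Module.finrank k A)) : A := Module.finBasis k A i

/-- The first family `x` of a pair of dual bases for `β`, so that `β (x i) (y j) = δ i j`. -/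
noncomputable def dualX : Fin (Module.finrank k A) → A :=
  β.form.dualBasis β.nondegenerate (Module.finBasis k A)

/-- The dual basis identity `a = ∑ i, β(a, y i) x i`. -/
theorem sum_dual (a : A) : ∑ i, β.form a (dualY (k := k) i) • β.dualX i = a := by
  have := (β.form.dualBasis β.nondegenerate (Module.finBasis k A)).sum_repr a
  simpa [dualX, dualY] using this

/-- The Higman trace `τ(a) = ∑ i, x i * a * y i` of `β`. -/
noncomputable def higmanTrace : A →ₗ[k] A :=
  ∑ i, LinearMap.mulLeft k (β.dualX i) ∘ₗ LinearMap.mulRight k (dualY (k := k) i)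

theorem higmanTrace_apply (a : A) :
    β.higmanTrace a = ∑ i, β.dualX i * a * dualY (k := k) i := by
  simp [higmanTrace, mul_assoc]

/-- Trace formula for arbitrary dual bases `x`, `y`. -/
theorem form_mul_eq_trace {ι : Type*} [Fintype ι] (x y : ι → A)
    (h : ∀ a, ∑ i, β.form a (y i) • x i = a) (a b : A) :
    β.form b (∑ i, x i * a * y i) =
      LinearMap.trace k A (LinearMap.mulLeft k b * LinearMap.mulRight k a) := by
  have key : LinearMap.mulLeft k b * LinearMap.mulRight k a =
      dualTensorHom k A A (∑ i, (β.form.flip (y i)) ⊗ₜ[k] (b * x i * a)) := by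
    ext z
    conv_lhs => rw [← h z]
    simp [mul_assoc]
  rw [key, LinearMap.trace_eq_contract_apply]
  simp [← β.assoc, mul_assoc]

/-- The Higman trace can be computed with arbitrary dual bases. -/
theorem higmanTrace_eq {ι : Type*} [Fintype ι] (x y : ι → A)
    (h : ∀ a, ∑ i, β.form a (y i) • x i = a) (a : A) :
    β.higmanTrace a = ∑ i, x i * a * y i := by
  rw [← sub_eq_zero]
  refine β.nondegenerate.2 _ fun b => ?_
  rw [map_sub, higmanTrace_apply, β.form_mul_eq_trace _ _ β.sum_dual, β.form_mul_eq_trace x y h,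
    sub_self]

theorem form_higmanTrace (a b : A) : β.form b (β.higmanTrace a) =
    LinearMap.trace k A (LinearMap.mulLeft k b * LinearMap.mulRight k a) := by
  rw [higmanTrace_apply, β.form_mul_eq_trace _ _ β.sum_dual]

theorem higmanTrace_commutator (x y : A) : β.higmanTrace (x * y - y * x) = 0 := by
  refine β.nondegenerate.2 _ fun b => ?_
  have h1 : LinearMap.mulLeft k b * LinearMap.mulRight k (x * y) =
      LinearMap.mulRight k y * (LinearMap.mulLeft k b * LinearMap.mulRight k x) := by
    ext z; simp [mul_assoc]
  have h2 : LinearMap.mulLeft k b * LinearMap.mulRight k (y * x) =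
      (LinearMap.mulLeft k b * LinearMap.mulRight k x) * LinearMap.mulRight k y := by
    ext z; simp [mul_assoc]
  rw [map_sub, map_sub, form_higmanTrace, form_higmanTrace, h1, h2, LinearMap.trace_mul_comm,
    sub_self]

theorem higmanTrace_jacobson {a : A} (ha : a ∈ Ring.jacobson A) : β.higmanTrace a = 0 := by
  have : IsArtinianRing A := IsArtinianRing.of_finite k A
  obtain ⟨n, hn⟩ := (inferInstance : IsSemiprimaryRing A).isNilpotent
  have han : a ^ n = 0 := by
    have := Ideal.pow_mem_pow ha n
    rwa [hn] at this
  refine β.nondegenerate.2 _ fun b => ?_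
  rw [form_higmanTrace]
  have hnil : IsNilpotent (LinearMap.mulLeft k b * LinearMap.mulRight k a) := by
    refine Commute.isNilpotent_mul_left ?_ ⟨n, ?_⟩
    · ext z; simp [mul_assoc]
    · rw [LinearMap.pow_mulRight, han, LinearMap.mulRight_zero_eq_zero]
  exact (LinearMap.isNilpotent_trace_of_isNilpotent hnil).eq_zero

/-- The canonical map `A → T(A / rad A)`. -/
noncomputable def can : A →ₗ[k] TraceSpace k (A ⧸ Ring.jacobson A) :=
  traceClass k ∘ₗ (Ideal.Quotient.mkₐ k (Ring.jacobson A)).toLinearMap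

/-- The map `A / rad A → A` induced by the Higman trace. -/
noncomputable def higmanTraceRad : (A ⧸ Ring.jacobson A) →ₗ[k] A :=
  ((Ring.jacobson A).restrictScalars k).liftQ β.higmanTrace
      (fun _ ha => LinearMap.mem_ker.2 (β.higmanTrace_jacobson ha)) ∘ₗ
    (Submodule.Quotient.restrictScalarsEquiv k (Ring.jacobson A)).symm.toLinearMap

/-- The map `τ̃ : T(A / rad A) → A` induced by the Higman trace. -/
noncomputable def higmanTraceTilde : TraceSpace k (A ⧸ Ring.jacobson A) →ₗ[k] A :=
  (commutatorSubmodule k (A ⧸ Ring.jacobson A)).liftQ β.higmanTraceRad <| by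
    rw [commutatorSubmodule, Submodule.span_le]
    rintro _ ⟨x, y, rfl⟩
    obtain ⟨x, rfl⟩ := Ideal.Quotient.mk_surjective x
    obtain ⟨y, rfl⟩ := Ideal.Quotient.mk_surjective y
    exact β.higmanTrace_commutator x y

/-- `τ = τ̃ ∘ can`. -/
theorem higmanTraceTilde_can (a : A) : β.higmanTraceTilde (can a) = β.higmanTrace a := rfl

end FrobeniusForm

end Frobenius

section Grothendieck

variable {A : Type u} [Ring A]

/-- Relations of the Grothendieck group of a class `C` of `A`-modules: `[V] = [U] + [W]` for every
exact sequence `0 → U → V → W → 0` of modules in `C`. -/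
def grothendieckRelations (C : ModuleCat.{u} A → Prop) :
    Set (FreeAbelianGroup {M : ModuleCat.{u} A // C M}) :=
  {x | ∃ (U V W : {M : ModuleCat.{u} A // C M}) (f : U.1 →ₗ[A] V.1) (g : V.1 →ₗ[A] W.1),
    Function.Injective f ∧ Function.Exact f g ∧ Function.Surjective g ∧
      x = FreeAbelianGroup.of V - (FreeAbelianGroup.of U + FreeAbelianGroup.of W)}

/-- The Grothendieck group of a class of `A`-modules. -/
abbrev Grothendieck (C : ModuleCat.{u} A → Prop) : Type (u + 1) :=
  FreeAbelianGroup {M : ModuleCat.{u} A // C M} ⧸ AddSubgroup.closure (grothendieckRelations C)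

namespace Grothendieck

variable {C D : ModuleCat.{u} A → Prop}

/-- The class `[M]`. -/
def cls (M : ModuleCat.{u} A) (h : C M) : Grothendieck C :=
  QuotientAddGroup.mk (FreeAbelianGroup.of ⟨M, h⟩)

theorem cls_eq_add {U V W : ModuleCat.{u} A} (hU : C U) (hV : C V) (hW : C W)
    (f : U →ₗ[A] V) (g : V →ₗ[A] W) (hf : Function.Injective f) (hfg : Function.Exact f g)
    (hg : Function.Surjective g) : cls V hV = cls U hU + cls W hW := by
  rw [← sub_eq_zero]
  exact (QuotientAddGroup.eq_zero_iff _).2 (AddSubgroup.subset_closure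
    ⟨⟨U, hU⟩, ⟨V, hV⟩, ⟨W, hW⟩, f, g, hf, hfg, hg, rfl⟩)

/-- The homomorphism given by an additive function. -/
noncomputable def lift {G : Type w} [AddCommGroup G] (φ : {M : ModuleCat.{u} A // C M} → G)
    (h : ∀ (U V W : {M : ModuleCat.{u} A // C M}) (f : U.1 →ₗ[A] V.1) (g : V.1 →ₗ[A] W.1),
      Function.Injective f → Function.Exact f g → Function.Surjective g → φ V = φ U + φ W) :
    Grothendieck C →+ G :=
  QuotientAddGroup.lift _ (FreeAbelianGroup.lift φ) <| by
    rw [AddSubgroup.closure_le]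
    rintro _ ⟨U, V, W, f, g, hf, hfg, hg, rfl⟩
    simp [h U V W f g hf hfg hg]

@[simp]
theorem lift_cls {G : Type w} [AddCommGroup G] (φ : {M : ModuleCat.{u} A // C M} → G) (h)
    (M : ModuleCat.{u} A) (hM : C M) : lift φ h (cls M hM) = φ ⟨M, hM⟩ :=
  FreeAbelianGroup.lift_apply_of ..

/-- The homomorphism `[M] ↦ [M]` given by an inclusion of classes of modules. -/
noncomputable def map (h : ∀ M, C M → D M) : Grothendieck C →+ Grothendieck D :=
  lift (fun M => cls M.1 (h M.1 M.2)) fun _ _ _ f g hf hfg hg => cls_eq_add _ _ _ f g hf hfg hg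

theorem map_cls (h : ∀ M, C M → D M) (M : ModuleCat.{u} A) (hM : C M) :
    map h (cls M hM) = cls M (h M hM) := lift_cls ..

theorem closure_cls : AddSubgroup.closure {x : Grothendieck C | ∃ M h, x = cls M h} = ⊤ := by
  rw [eq_top_iff]
  rintro x -
  obtain ⟨x, rfl⟩ := QuotientAddGroup.mk_surjective x
  induction x using FreeAbelianGroup.induction_on with
  | zero => exact zero_mem _
  | of M => exact AddSubgroup.subset_closure ⟨M.1, M.2, rfl⟩
  | neg M h => exact neg_mem h
  | add x y hx hy => exact add_mem hx hy

end Grothendieck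

variable (A)

/-- `G₀(A)`, the Grothendieck group of all finitely generated `A`-modules. -/
abbrev G0 : Type (u + 1) := Grothendieck fun M : ModuleCat.{u} A => Module.Finite A M

/-- `K₀(A)`, the Grothendieck group of all finitely generated projective `A`-modules. -/
abbrev K0 : Type (u + 1) :=
  Grothendieck fun M : ModuleCat.{u} A => Module.Finite A M ∧ Module.Projective A M

/-- The Cartan map `c : K₀(A) → G₀(A)`, `[P] ↦ [P]`. -/
noncomputable def cartanMap : K0 A →ₗ[ℤ] G0 A :=
  (Grothendieck.map fun _ h => h.1).toIntLinearMap

end Grothendieck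

section Irreducible

variable (A : Type u) [Ring A]

/-- Isomorphism of simple modules `A / m`, `m` a maximal left ideal. -/
def maximalSetoid : Setoid {m : Ideal A // m.IsMaximal} where
  r m n := Nonempty ((A ⧸ m.1) ≃ₗ[A] (A ⧸ n.1))
  iseqv := ⟨fun _ => ⟨.refl A _⟩, fun ⟨e⟩ => ⟨e.symm⟩, fun ⟨e⟩ ⟨f⟩ => ⟨e.trans f⟩⟩

/-- The set of isomorphism classes of irreducible left `A`-modules. As each irreducible module is
isomorphic to `A / m` for some maximal left ideal `m`, these are the classes of the `A / m`. -/
def Irr : Type u := Quotient (maximalSetoid A)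

variable {A}

/-- A maximal left ideal `m` such that `A / m` belongs to the class `i`. -/
noncomputable def Irr.ideal (i : Irr A) : Ideal A := (Quotient.out i).1

instance (i : Irr A) : i.ideal.IsMaximal := (Quotient.out i).2

/-- An irreducible module in the class `i`. -/
abbrev Irr.V (i : Irr A) : Type u := A ⧸ i.ideal

instance (i : Irr A) : IsSimpleModule A i.V :=
  isSimpleModule_iff_isCoatom.2 (Ideal.isMaximal_def.1 inferInstance)

theorem Irr.eq_of_equiv {i j : Irr A} (e : i.V ≃ₗ[A] j.V) : i = j := by
  rw [← Quotient.out_eq i, ← Quotient.out_eq j]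
  exact Quotient.sound ⟨e⟩

theorem Irr.exists_equiv (M : Type u) [AddCommGroup M] [Module A M] [IsSimpleModule A M] :
    ∃ i : Irr A, Nonempty (M ≃ₗ[A] i.V) := by
  obtain ⟨m, hm, ⟨e⟩⟩ := isSimpleModule_iff_quot_maximal.1 (inferInstance : IsSimpleModule A M)
  obtain ⟨f⟩ := Quotient.exact (Quotient.out_eq (Quotient.mk (maximalSetoid A) ⟨m, hm⟩))
  exact ⟨Quotient.mk (maximalSetoid A) ⟨m, hm⟩, ⟨e.trans f.symm⟩⟩

/-- `π : P → V` is a projective cover: `P` is projective, and `π` is an epimorphism with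
superfluous kernel. -/
structure IsProjectiveCover {P V : Type u} [AddCommGroup P] [AddCommGroup V] [Module A P]
    [Module A V] (π : P →ₗ[A] V) : Prop where
  projective : Module.Projective A P
  surjective : Function.Surjective π
  superfluous : ∀ N : Submodule A P, N ⊔ LinearMap.ker π = ⊤ → N = ⊤

theorem IsProjectiveCover.surjective_of_comp {P V M : Type u} [AddCommGroup P] [AddCommGroup V]
    [AddCommGroup M] [Module A P] [Module A V] [Module A M] {π : P →ₗ[A] V}
    (h : IsProjectiveCover π) (f : M →ₗ[A] P) (hf : Function.Surjective (π ∘ₗ f)) :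
    Function.Surjective f := by
  rw [← LinearMap.range_eq_top]
  refine h.superfluous _ (eq_top_iff.2 fun x _ => ?_)
  obtain ⟨m, hm⟩ := hf (π x)
  refine Submodule.mem_sup.2 ⟨f m, ⟨m, rfl⟩, x - f m, ?_, by abel⟩
  simpa [sub_eq_zero] using hm.symm

theorem exists_isProjectiveCover [IsArtinianRing A] (i : Irr A) :
    ∃ (L : Ideal A) (π : L →ₗ[A] i.V), IsProjectiveCover π := by
  let S : Set (Ideal A) := {L | L ⊔ i.ideal = ⊤}
  obtain ⟨L, hL, hmin⟩ := wellFounded_lt.has_min S ⟨⊤, by simp [S]⟩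
  let q : A →ₗ[A] i.V := i.ideal.mkQ
  let π : L →ₗ[A] i.V := q ∘ₗ L.subtype
  have hq : Function.Surjective q := Submodule.mkQ_surjective _
  have hπ : Function.Surjective π := by
    intro x
    obtain ⟨a, rfl⟩ := hq x
    have : a ∈ L ⊔ i.ideal := by rw [show L ⊔ i.ideal = ⊤ from hL]; trivial
    obtain ⟨l, hl, m, hm, rfl⟩ := Submodule.mem_sup.1 this
    refine ⟨⟨l, hl⟩, ?_⟩
    simpa [π, q, Submodule.Quotient.eq] using hm
  have hsup : ∀ N : Submodule A L, N ⊔ LinearMap.ker π = ⊤ → N = ⊤ := by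
    intro N hN
    have hNS : N.map L.subtype ∈ S := by
      refine eq_top_iff.2 fun a _ => ?_
      have : a ∈ L ⊔ i.ideal := by rw [show L ⊔ i.ideal = ⊤ from hL]; trivial
      obtain ⟨l, hl, m, hm, rfl⟩ := Submodule.mem_sup.1 this
      have : (⟨l, hl⟩ : L) ∈ N ⊔ LinearMap.ker π := by rw [hN]; trivial
      obtain ⟨x, hx, y, hy, hxy⟩ := Submodule.mem_sup.1 this
      have hy' : (y : A) ∈ i.ideal := by simpa [π, q] using hy
      have : l = x + y := by simpa using congrArg Subtype.val hxy.symm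
      exact Submodule.mem_sup.2
        ⟨x, ⟨x, hx, rfl⟩, y + m, add_mem hy' hm, by rw [this]; abel⟩
    have hle : N.map L.subtype ≤ L := Submodule.map_subtype_le _ _
    have heq : N.map L.subtype = L := by
      by_contra hne
      exact hmin _ hNS (lt_of_le_of_ne hle hne)
    rw [eq_top_iff]
    rintro ⟨l, hl⟩ -
    rw [← heq] at hl
    obtain ⟨x, hx, hxl⟩ := hl
    have : x = ⟨l, by rw [← heq]; exact ⟨x, hx, hxl⟩⟩ := Subtype.ext hxl
    rwa [← this]
  obtain ⟨h, hh⟩ := Module.projective_lifting_property π q hπ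
  have hsurj : Function.Surjective (h ∘ₗ L.subtype) := by
    rw [← LinearMap.range_eq_top]
    refine hsup _ (eq_top_iff.2 fun x _ => ?_)
    refine Submodule.mem_sup.2 ⟨h x, ⟨x, rfl⟩, x - h x, ?_, by abel⟩
    have : π (h x) = q x := LinearMap.congr_fun hh x
    rw [LinearMap.mem_ker, map_sub, this]
    exact sub_self _
  have hinj := IsNoetherian.injective_of_surjective_endomorphism _ hsurj
  let e := LinearEquiv.ofBijective _ ⟨hinj, hsurj⟩
  refine ⟨L, π, Module.Projective.of_split L.subtype (e.symm.toLinearMap ∘ₗ h) ?_, hπ, hsup⟩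
  exact LinearMap.ext fun x => e.symm_apply_apply x

variable [IsArtinianRing A]

/-- A projective cover `P → V` of the irreducible module `V` in the class `i`. -/
noncomputable def Irr.P (i : Irr A) : Ideal A := (exists_isProjectiveCover i).choose

/-- The covering map. -/
noncomputable def Irr.π (i : Irr A) : i.P →ₗ[A] i.V := (exists_isProjectiveCover i).choose_spec.choose

theorem Irr.isProjectiveCover (i : Irr A) : IsProjectiveCover i.π :=
  (exists_isProjectiveCover i).choose_spec.choose_spec

instance (i : Irr A) : Module.Projective A i.P := i.isProjectiveCover.projective

theorem Irr.eq_of_ne_zero {i j : Irr A} (f : i.P →ₗ[A] j.V) (hf : f ≠ 0) : i = j := by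
  have hs : Function.Surjective f := LinearMap.surjective_of_ne_zero hf
  have h1 : IsCoatom (LinearMap.ker f) :=
    isSimpleModule_iff_isCoatom.1 (.congr (f.quotKerEquivOfSurjective hs))
  have h2 : IsCoatom (LinearMap.ker i.π) :=
    isSimpleModule_iff_isCoatom.1 (.congr (i.π.quotKerEquivOfSurjective i.isProjectiveCover.surjective))
  have h3 : LinearMap.ker f = LinearMap.ker i.π := by
    by_contra hne
    exact h1.1 (i.isProjectiveCover.superfluous _ (h1.sup_eq_top_of_ne h2 hne))
  exact Irr.eq_of_equiv (((i.π.quotKerEquivOfSurjective i.isProjectiveCover.surjective).symm.trans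
    (Submodule.quotEquivOfEq _ _ h3.symm)).trans (f.quotKerEquivOfSurjective hs))

theorem Irr.π_ne_zero (i : Irr A) : i.π ≠ 0 := by
  intro h
  have := IsSimpleModule.nontrivial A i.V
  obtain ⟨x, hx⟩ := exists_ne (0 : i.V)
  obtain ⟨y, rfl⟩ := i.isProjectiveCover.surjective x
  exact hx (by rw [h]; rfl)

theorem Irr.nontrivial_P (i : Irr A) : Nontrivial i.P := by
  rw [← not_subsingleton_iff_nontrivial]
  exact fun _ => i.π_ne_zero (Subsingleton.elim _ _)

end Irreducible


section Bases

open scoped ModuleCat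

variable (k : Type v) {A : Type u} [Field k] [Ring A] [Algebra k A]

theorem finrank_of_exact {X Y Z : Type*} [AddCommGroup X] [AddCommGroup Y] [AddCommGroup Z]
    [Module k X] [Module k Y] [Module k Z] [Module.Finite k Y] (f : X →ₗ[k] Y) (g : Y →ₗ[k] Z)
    (hf : Function.Injective f) (hfg : Function.Exact f g) (hg : Function.Surjective g) :
    Module.finrank k Y = Module.finrank k X + Module.finrank k Z := by
  rw [← g.finrank_range_add_finrank_ker, LinearMap.range_eq_top.2 hg, finrank_top,
    hfg.linearMap_ker_eq, LinearMap.finrank_range_of_inj hf, add_comm]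

section Hom

variable {P M U V W : Type u} [AddCommGroup P] [AddCommGroup M] [AddCommGroup U] [AddCommGroup V]
  [AddCommGroup W] [Module A P] [Module A M] [Module A U] [Module A V] [Module A W]
  [Module k P] [Module k M] [Module k V]
  [IsScalarTower k A P] [IsScalarTower k A M] [IsScalarTower k A V]

theorem finite_hom [Module.Finite k P] [Module.Finite k M] : Module.Finite k (P →ₗ[A] M) :=
  Module.Finite.of_injective (LinearMap.restrictScalarsₗ k A P M k)
    (LinearMap.restrictScalars_injective k)

theorem finrank_hom_of_exact [Module k U] [Module k W] [IsScalarTower k A U]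
    [IsScalarTower k A W] [Module.Finite k P] [Module.Finite k V] [Module.Projective A P]
    (f : U →ₗ[A] V) (g : V →ₗ[A] W)
    (hf : Function.Injective f) (hfg : Function.Exact f g) (hg : Function.Surjective g) :
    Module.finrank k (P →ₗ[A] V) = Module.finrank k (P →ₗ[A] U) + Module.finrank k (P →ₗ[A] W) := by
  have := finite_hom k (A := A) (P := P) (M := V)
  let F : (P →ₗ[A] U) →ₗ[k] (P →ₗ[A] V) :=
    { toFun := fun φ => f ∘ₗ φ
      map_add' := fun _ _ => LinearMap.comp_add ..
      map_smul' := fun c φ => by ext x; exact f.map_smul_of_tower c (φ x) }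
  let G : (P →ₗ[A] V) →ₗ[k] (P →ₗ[A] W) :=
    { toFun := fun φ => g ∘ₗ φ
      map_add' := fun _ _ => LinearMap.comp_add ..
      map_smul' := fun c φ => by ext x; exact g.map_smul_of_tower c (φ x) }
  refine finrank_of_exact k F G (fun a b h => ?_) (fun φ => ⟨fun h => ?_, ?_⟩) fun φ => ?_
  · ext x; exact hf (LinearMap.congr_fun h x)
  · let e := LinearEquiv.ofInjective f hf
    have hr : ∀ x, φ x ∈ LinearMap.range f := fun x => (hfg _).1 (LinearMap.congr_fun h x)
    refine ⟨e.symm.toLinearMap ∘ₗ φ.codRestrict _ hr, ?_⟩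
    ext x
    exact congrArg Subtype.val (e.apply_symm_apply ⟨φ x, hr x⟩)
  · rintro ⟨ψ, rfl⟩
    ext x
    exact hfg.apply_apply_eq_zero (ψ x)
  · exact Module.projective_lifting_property g φ hg

theorem finrank_hom_of_exact' [Module.Finite k M] [Module.Finite k V] [Module.Projective A W]
    (f : U →ₗ[A] V) (g : V →ₗ[A] W)
    (hf : Function.Injective f) (hfg : Function.Exact f g) (hg : Function.Surjective g) :
    Module.finrank k (V →ₗ[A] M) = Module.finrank k (U →ₗ[A] M) + Module.finrank k (W →ₗ[A] M) := by
  have := finite_hom k (A := A) (P := V) (M := M)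
  let F : (V →ₗ[A] M) →ₗ[k] (U →ₗ[A] M) :=
    { toFun := fun φ => φ ∘ₗ f
      map_add' := fun _ _ => LinearMap.add_comp ..
      map_smul' := fun c φ => rfl }
  let G : (W →ₗ[A] M) →ₗ[k] (V →ₗ[A] M) :=
    { toFun := fun φ => φ ∘ₗ g
      map_add' := fun _ _ => LinearMap.add_comp ..
      map_smul' := fun c φ => rfl }
  rw [add_comm]
  obtain ⟨s, hs⟩ := Module.projective_lifting_property g LinearMap.id hg
  have hs' : ∀ w, g (s w) = w := LinearMap.congr_fun hs
  let e := LinearEquiv.ofInjective f hf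
  have hr : ∀ x, (LinearMap.id - s ∘ₗ g : V →ₗ[A] V) x ∈ LinearMap.range f := fun x =>
    (hfg _).1 (by simp [hs'])
  let r : V →ₗ[A] U := e.symm.toLinearMap ∘ₗ (LinearMap.id - s ∘ₗ g : V →ₗ[A] V).codRestrict _ hr
  have hfr : ∀ x, f (r x) = x - s (g x) := fun x =>
    congrArg Subtype.val (e.apply_symm_apply ⟨_, hr x⟩)
  refine finrank_of_exact k G F (fun a b h => ?_) (fun φ => ⟨fun h => ?_, ?_⟩) fun φ => ?_
  · ext x
    obtain ⟨y, rfl⟩ := hg x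
    exact LinearMap.congr_fun h y
  · refine ⟨φ ∘ₗ s, ?_⟩
    ext x
    have : φ (f (r x)) = 0 := LinearMap.congr_fun h (r x)
    rw [hfr, map_sub, sub_eq_zero] at this
    exact this.symm
  · rintro ⟨ψ, rfl⟩
    ext x
    change ψ (g (f x)) = 0
    rw [hfg.apply_apply_eq_zero, map_zero]
  · refine ⟨φ ∘ₗ r, ?_⟩
    ext x
    change φ (r (f x)) = φ x
    congr 1
    apply hf
    rw [hfr, hfg.apply_apply_eq_zero, map_zero, sub_zero]

end Hom

theorem linearIndependent_of_pairing {ι : Type*} {N : Type*} [AddCommGroup N] (x : ι → N)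
    (h : ι → N →+ ℤ) (h0 : ∀ i j, i ≠ j → h i (x j) = 0) (h1 : ∀ i, h i (x i) ≠ 0) :
    LinearIndependent ℤ x := by
  rw [linearIndependent_iff']
  intro s g hg i hi
  have := congrArg (h i) hg
  rw [map_sum, Finset.sum_eq_single i] at this
  · simpa [h1 i] using this
  · intro j _ hj
    simp [h0 i j hj.symm]
  · exact fun h => absurd hi h

variable [Module.Finite k A]

theorem finite_restrict (M : ModuleCat.{u} A) [Module.Finite A M] : Module.Finite k M :=
  Module.Finite.trans A M

variable [IsArtinianRing A]

/-- `[V]` for the irreducible module `V` in the class `i`. -/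
noncomputable def irrClass (i : Irr A) : G0 A :=
  Grothendieck.cls (.of A i.V) (inferInstanceAs (Module.Finite A i.V))

/-- `[P]` for the projective cover `P` of the irreducible module in the class `i`. -/
noncomputable def projClass (i : Irr A) : K0 A :=
  Grothendieck.cls (.of A i.P)
    ⟨inferInstanceAs (Module.Finite A i.P), inferInstanceAs (Module.Projective A i.P)⟩

/-- `[M] ↦ dim Hom(P, M)`. -/
noncomputable def homFromP (i : Irr A) : G0 A →+ ℤ :=
  Grothendieck.lift (fun M => (Module.finrank k (i.P →ₗ[A] M.1) : ℤ)) <| by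
    rintro ⟨U, hU⟩ ⟨V, hV⟩ ⟨W, hW⟩ f g hf hfg hg
    have := finite_restrict k V
    exact_mod_cast finrank_hom_of_exact k f g hf hfg hg

/-- `[P] ↦ dim Hom(P, V)`. -/
noncomputable def homToV (i : Irr A) : K0 A →+ ℤ :=
  Grothendieck.lift (fun M => (Module.finrank k (M.1 →ₗ[A] i.V) : ℤ)) <| by
    rintro ⟨U, hU⟩ ⟨V, hV⟩ ⟨W, hW⟩ f g hf hfg hg
    have := hV.1
    have := hW.2
    have := finite_restrict k V
    exact_mod_cast finrank_hom_of_exact' k f g hf hfg hg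


theorem homFromP_cls_eq_zero (i : Irr A) (M : ModuleCat.{u} A) (hM : Module.Finite A M)
    (h : Subsingleton (i.P →ₗ[A] M)) : homFromP k i (Grothendieck.cls M hM) = 0 := by
  rw [homFromP, Grothendieck.lift_cls]
  exact_mod_cast Module.finrank_zero_of_subsingleton

theorem homFromP_cls_ne_zero (i : Irr A) (M : ModuleCat.{u} A) (hM : Module.Finite A M)
    (h : Nontrivial (i.P →ₗ[A] M)) : homFromP k i (Grothendieck.cls M hM) ≠ 0 := by
  rw [homFromP, Grothendieck.lift_cls]
  have := finite_restrict k M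
  have := finite_hom k (A := A) (P := i.P) (M := M)
  exact_mod_cast (Module.finrank_pos (R := k) (M := i.P →ₗ[A] M)).ne'

theorem homFromP_irrClass_of_ne {i j : Irr A} (h : i ≠ j) : homFromP k i (irrClass j) = 0 := by
  have : ∀ f : i.P →ₗ[A] j.V, f = 0 := fun f => by
    by_contra hf
    exact h (Irr.eq_of_ne_zero f hf)
  exact homFromP_cls_eq_zero k i _ _ ⟨fun f g => by rw [this f, this g]⟩

theorem homFromP_irrClass_self (i : Irr A) : homFromP k i (irrClass i) ≠ 0 :=
  homFromP_cls_ne_zero k i _ _ ⟨i.π, 0, i.π_ne_zero⟩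

theorem homToV_projClass_of_ne {i j : Irr A} (h : i ≠ j) : homToV k i (projClass j) = 0 := by
  have : ∀ f : j.P →ₗ[A] i.V, f = 0 := fun f => by
    by_contra hf
    exact h (Irr.eq_of_ne_zero f hf).symm
  have : Subsingleton (j.P →ₗ[A] i.V) := ⟨fun f g => by rw [this f, this g]⟩
  rw [homToV, projClass, Grothendieck.lift_cls]
  exact_mod_cast Module.finrank_zero_of_subsingleton

theorem homToV_projClass_self (i : Irr A) : homToV k i (projClass i) ≠ 0 := by
  rw [homToV, projClass, Grothendieck.lift_cls]
  have := finite_hom k (A := A) (P := i.P) (M := i.V)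
  have : Nontrivial (i.P →ₗ[A] i.V) := ⟨i.π, 0, i.π_ne_zero⟩
  exact_mod_cast (Module.finrank_pos (R := k) (M := i.P →ₗ[A] i.V)).ne'

end Bases

section ExplicitBases

open scoped ModuleCat

theorem linearIndependent_irrClass (k : Type v) (A : Type u) [Field k] [Ring A] [Algebra k A]
    [Module.Finite k A] [IsArtinianRing A] : LinearIndependent ℤ (irrClass (A := A)) :=
  linearIndependent_of_pairing _ (homFromP k) (fun _ _ h => homFromP_irrClass_of_ne k h)
    (homFromP_irrClass_self k)

theorem linearIndependent_projClass (k : Type v) (A : Type u) [Field k] [Ring A] [Algebra k A]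
    [Module.Finite k A] [IsArtinianRing A] : LinearIndependent ℤ (projClass (A := A)) :=
  linearIndependent_of_pairing _ (homToV k) (fun _ _ h => homToV_projClass_of_ne k h)
    (homToV_projClass_self k)

theorem cls_mem_span_irrClass {A : Type u} [Ring A] (M : Type u) [AddCommGroup M] [Module A M] (hl : IsFiniteLength A M)
    (hM : Module.Finite A M) :
    (Grothendieck.cls (.of A M) hM : G0 A) ∈ Submodule.span ℤ (Set.range (irrClass (A := A))) := by
  induction hl with
  | @of_subsingleton M _ _ _ =>
    have := Grothendieck.cls_eq_add (C := fun M : ModuleCat.{u} A => Module.Finite A M)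
      (U := .of A M) (V := .of A M) (W := .of A M) hM hM hM (0 : M →ₗ[A] M) 0
      (Function.injective_of_subsingleton _)
      (fun x => by simp [Subsingleton.elim x 0]) (fun x => ⟨0, Subsingleton.elim _ _⟩)
    rw [left_eq_add] at this
    rw [this]
    exact zero_mem _
  | @of_simple_quotient M _ _ N _ hN ih =>
    obtain ⟨i, ⟨e⟩⟩ := Irr.exists_equiv (A := A) (M ⧸ N)
    have := (isFiniteLength_iff_isNoetherian_isArtinian.1 hN).1
    rw [Grothendieck.cls_eq_add (C := fun M : ModuleCat.{u} A => Module.Finite A M)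
      (U := .of A N) (W := .of A i.V) inferInstance hM (inferInstanceAs (Module.Finite A i.V))
      N.subtype (e.toLinearMap ∘ₗ N.mkQ) N.injective_subtype
      (fun x => by simp) (e.surjective.comp N.mkQ_surjective)]
    exact add_mem (ih _) (Submodule.subset_span ⟨i, rfl⟩)

theorem span_irrClass (A : Type u) [Ring A] [IsArtinianRing A] : ⊤ ≤ Submodule.span ℤ (Set.range (irrClass (A := A))) := by
  have h : AddSubgroup.closure {x : G0 A | ∃ M h, x = Grothendieck.cls M h} ≤
      (Submodule.span ℤ (Set.range (irrClass (A := A)))).toAddSubgroup := by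
    rw [AddSubgroup.closure_le]
    rintro _ ⟨M, hM, rfl⟩
    exact cls_mem_span_irrClass M (isFiniteLength_iff_isNoetherian_isArtinian.2
      ⟨inferInstance, inferInstance⟩) hM
  rw [Grothendieck.closure_cls] at h
  exact fun x _ => h (AddSubgroup.mem_top x)

theorem cls_mem_span_projClass (k : Type v) {A : Type u} [Field k] [Ring A] [Algebra k A]
    [Module.Finite k A] [IsArtinianRing A] (n : ℕ) : ∀ (M : ModuleCat.{u} A)
    (hM : Module.Finite A M ∧ Module.Projective A M), Module.finrank k M = n →
    (Grothendieck.cls M hM : K0 A) ∈ Submodule.span ℤ (Set.range (projClass (A := A))) := by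
  induction n using Nat.strong_induction_on with
  | _ n ih =>
    intro M hM hn
    have := hM.1
    have := hM.2
    have := finite_restrict k M
    rcases subsingleton_or_nontrivial M with hs | hnt
    · have := Grothendieck.cls_eq_add
        (C := fun M : ModuleCat.{u} A => Module.Finite A M ∧ Module.Projective A M)
        hM hM hM (0 : M →ₗ[A] M) 0 (Function.injective_of_subsingleton _)
        (fun x => by simp [Subsingleton.elim x 0]) (fun x => ⟨0, Subsingleton.elim _ _⟩)
      rw [left_eq_add] at this
      rw [this]
      exact zero_mem _
    · obtain ⟨N, hN, -⟩ := (eq_top_or_exists_le_coatom (⊥ : Submodule A M)).resolve_left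
        bot_ne_top
      have := isSimpleModule_iff_isCoatom.2 hN
      obtain ⟨i, ⟨e⟩⟩ := Irr.exists_equiv (A := A) (M ⧸ N)
      let q : M →ₗ[A] i.V := e.toLinearMap ∘ₗ N.mkQ
      have hq : Function.Surjective q := e.surjective.comp N.mkQ_surjective
      obtain ⟨φ, hφ⟩ := Module.projective_lifting_property i.π q i.isProjectiveCover.surjective
      have hφs : Function.Surjective φ :=
        i.isProjectiveCover.surjective_of_comp φ (by rw [hφ]; exact hq)
      obtain ⟨s, hs⟩ := Module.projective_lifting_property φ LinearMap.id hφs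
      have hs' : ∀ w, φ (s w) = w := LinearMap.congr_fun hs
      have hproj : Module.Projective A (LinearMap.ker φ) :=
        Module.Projective.of_split (LinearMap.ker φ).subtype
          ((LinearMap.id - s ∘ₗ φ : M →ₗ[A] M).codRestrict _ fun x => by simp [hs'])
          (by ext x; simp)
      have hex : Function.Exact (LinearMap.ker φ).subtype φ := fun x => by simp
      rw [Grothendieck.cls_eq_add
        (C := fun M : ModuleCat.{u} A => Module.Finite A M ∧ Module.Projective A M)
        (U := .of A (LinearMap.ker φ)) (W := .of A i.P) ⟨inferInstance, hproj⟩ hM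
        ⟨inferInstanceAs (Module.Finite A i.P), inferInstanceAs (Module.Projective A i.P)⟩
        (LinearMap.ker φ).subtype φ (Submodule.injective_subtype _) hex hφs]
      refine add_mem (ih _ ?_ _ _ rfl) (Submodule.subset_span ⟨i, rfl⟩)
      have hd := finrank_of_exact k ((LinearMap.ker φ).subtype.restrictScalars k)
        (φ.restrictScalars k) (Submodule.injective_subtype _) hex hφs
      have : Nontrivial i.P := i.nontrivial_P
      have hp : 0 < Module.finrank k i.P := Module.finrank_pos
      refine lt_of_lt_of_le (Nat.lt_add_of_pos_right hp) (le_of_eq ?_)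
      exact hd.symm.trans hn

theorem span_projClass (k : Type v) (A : Type u) [Field k] [Ring A] [Algebra k A]
    [Module.Finite k A] [IsArtinianRing A] : ⊤ ≤ Submodule.span ℤ (Set.range (projClass (A := A))) := by
  have h : AddSubgroup.closure {x : K0 A | ∃ M h, x = Grothendieck.cls M h} ≤
      (Submodule.span ℤ (Set.range (projClass (A := A)))).toAddSubgroup := by
    rw [AddSubgroup.closure_le]
    rintro _ ⟨M, hM, rfl⟩
    exact cls_mem_span_projClass k _ M hM rfl
  rw [Grothendieck.closure_cls] at h
  exact fun x _ => h (AddSubgroup.mem_top x)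

/-- The basis `[V]`, `V` irreducible, of `G₀(A)`. -/
noncomputable def irrBasis (k : Type v) (A : Type u) [Field k] [Ring A] [Algebra k A]
    [Module.Finite k A] [IsArtinianRing A] : Module.Basis (Irr A) ℤ (G0 A) :=
  .mk (linearIndependent_irrClass k A) (span_irrClass A)

/-- The basis `[P]`, `P` a projective cover of an irreducible module, of `K₀(A)`. -/
noncomputable def projBasis (k : Type v) (A : Type u) [Field k] [Ring A] [Algebra k A]
    [Module.Finite k A] [IsArtinianRing A] : Module.Basis (Irr A) ℤ (K0 A) :=
  .mk (linearIndependent_projClass k A) (span_projClass k A)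

theorem finite_irr (k : Type v) (A : Type u) [Field k] [Ring A] [Algebra k A]
    [Module.Finite k A] [IsArtinianRing A] : Finite (Irr A) := by
  let a : G0 A := Grothendieck.cls (.of A A) (inferInstanceAs (Module.Finite A A))
  have ha : ∀ i, homFromP k i a ≠ 0 := by
    intro i
    have := i.nontrivial_P
    obtain ⟨x, hx⟩ := exists_ne (0 : i.P)
    exact homFromP_cls_ne_zero k i _ _
      ⟨Submodule.subtype _, 0, fun h => hx (Subtype.ext (LinearMap.congr_fun h x))⟩
  have hs : ∀ i, i ∈ ((irrBasis k A).repr a).support := by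
    intro i
    by_contra hi
    apply ha i
    rw [← (irrBasis k A).linearCombination_repr a, Finsupp.linearCombination_apply, Finsupp.sum,
      map_sum]
    refine Finset.sum_eq_zero fun j hj => ?_
    have hij : i ≠ j := fun h => hi (h ▸ hj)
    rw [map_zsmul, irrBasis, Module.Basis.mk_apply, homFromP_irrClass_of_ne k hij, smul_zero]
  exact Finite.of_injective (fun i => (⟨i, hs i⟩ : ((irrBasis k A).repr a).support))
    fun i j h => congrArg Subtype.val h

end ExplicitBases

section Cartan

variable (k : Type v) (A : Type u) [Field k] [Ring A] [Algebra k A] [Module.Finite k A]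

noncomputable instance : DecidableEq (Irr A) := Classical.decEq _

/-- The Cartan matrix `C` of `A`: the matrix of the Cartan map `c : K₀(A) → G₀(A)` with respect to
the basis `[P]`, where `P` is the projective cover of `V`, of `K₀(A)`, and the basis `[V]` of
`G₀(A)`, where `V` runs over the irreducible modules. -/
noncomputable def cartanMatrix : Matrix (Irr A) (Irr A) ℤ :=
  haveI := IsArtinianRing.of_finite k A
  letI := @Fintype.ofFinite (Irr A) (finite_irr k A)
  LinearMap.toMatrix (projBasis k A) (irrBasis k A) (cartanMap A)

/-- The determinant of the Cartan matrix. -/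
noncomputable def cartanDet : ℤ :=
  haveI := IsArtinianRing.of_finite k A
  letI := @Fintype.ofFinite (Irr A) (finite_irr k A)
  (cartanMatrix k A).det

end Cartan

section Splitting

/-- `k` is a splitting field for `A`: `End_A(V) = k` for all irreducible `A`-modules `V`. -/
def IsSplittingFieldFor (k : Type v) (A : Type u) [Field k] [Ring A] [Algebra k A] : Prop :=
  ∀ (V : Type u) [AddCommGroup V] [Module A V] [IsSimpleModule A V] (φ : V →ₗ[A] V),
    ∃ c : k, ∀ x : V, φ x = algebraMap k A c • x

end Splitting

end FrobeniusCartan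

/-!
The isomorphism `K₀(A) ⊗ k ≃ T(A / rad A)` sending `[A e]` to the class of the idempotent `e`, the
embedding `G₀(A) ⊗ k → A^*` by characters (injective because `k` is a splitting field) and the
embedding `A → A^*` given by `β` carry `τ̃` to `c ⊗ 1`: indeed `β(b, τ(e))` is the trace of
`x ↦ b x e` on `A`, which is the trace of `b` on `A e`. So `τ` and `c ⊗ 1` have the same rank, and
`τ̃` is injective as soon as `det C` is nonzero in `k`.

As `rad A · τ(A) = 0`, a unit in the image of `τ` forces `rad A = 0`. Conversely, for semisimple `A`
and a primitive idempotent `e_i` for each irreducible module, `β(b, τ(∑ e_i))` is the value at `b`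
of the sum of the irreducible characters. This sum is a nondegenerate trace form, hence `τ(∑ e_i)`
is a unit.
-/

namespace FrobeniusCartan

section LinearAlgebra

variable {k : Type*} [Field k]

theorem exists_splitting_of_exact {U V W : Type*} [AddCommGroup U] [AddCommGroup V]
    [AddCommGroup W] [Module k U] [Module k V] [Module k W] {f : U →ₗ[k] V} {g : V →ₗ[k] W}
    (hf : Function.Injective f) (hfg : Function.Exact f g) (hg : Function.Surjective g) :
    ∃ (p : V →ₗ[k] U) (s : W →ₗ[k] V),
      p ∘ₗ f = LinearMap.id ∧ g ∘ₗ s = LinearMap.id ∧ f ∘ₗ p + s ∘ₗ g = LinearMap.id := by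
  obtain ⟨s, hs⟩ := g.exists_rightInverse_of_surjective (LinearMap.range_eq_top.2 hg)
  obtain ⟨e, hfe, hge⟩ := hfg.splitSurjectiveEquiv hf ⟨s, hs⟩
  refine ⟨LinearMap.fst k U W ∘ₗ e, e.symm ∘ₗ LinearMap.inr k U W, ?_, ?_, ?_⟩
  · ext x; simp [hfe]
  · ext x; simp [hge]
  · ext x; simp [hfe, hge, ← map_add]

theorem trace_eq_add_of_exact {U V W : Type*} [AddCommGroup U] [AddCommGroup V] [AddCommGroup W]
    [Module k U] [Module k V] [Module k W] [Module.Finite k V] {f : U →ₗ[k] V} {g : V →ₗ[k] W}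
    (hf : Function.Injective f) (hfg : Function.Exact f g) (hg : Function.Surjective g)
    {u : Module.End k U} {v : Module.End k V} {w : Module.End k W}
    (huv : v ∘ₗ f = f ∘ₗ u) (hvw : g ∘ₗ v = w ∘ₗ g) :
    LinearMap.trace k V v = LinearMap.trace k U u + LinearMap.trace k W w := by
  have : Module.Finite k U := .of_injective f hf
  have : Module.Finite k W := .of_surjective g hg
  obtain ⟨p, s, hpf, hgs, hsplit⟩ := exists_splitting_of_exact hf hfg hg
  calc LinearMap.trace k V v
      = LinearMap.trace k V ((v ∘ₗ f) ∘ₗ p + (v ∘ₗ s) ∘ₗ g) := by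
        rw [LinearMap.comp_assoc, LinearMap.comp_assoc, ← LinearMap.comp_add, hsplit,
          LinearMap.comp_id]
    _ = LinearMap.trace k U (p ∘ₗ v ∘ₗ f) + LinearMap.trace k W (g ∘ₗ v ∘ₗ s) := by
        rw [map_add, LinearMap.trace_comp_comm', LinearMap.trace_comp_comm' g]
    _ = LinearMap.trace k U u + LinearMap.trace k W w := by
        rw [huv, ← LinearMap.comp_assoc, hpf, LinearMap.id_comp, ← LinearMap.comp_assoc, hvw,
          LinearMap.comp_assoc, hgs, LinearMap.comp_id]

variable {V W X : Type*} [AddCommGroup V] [AddCommGroup W] [AddCommGroup X]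
  [Module k V] [Module k W] [Module k X]

theorem apply_eq_trace_smul [Module.Finite k V] {f : Module.End k V} {v : V}
    (h : ∀ x, f x ∈ Submodule.span k {v}) : f v = LinearMap.trace k V f • v := by
  rcases eq_or_ne v 0 with rfl | hv
  · rw [map_zero, smul_zero]
  obtain ⟨g, hg⟩ := Module.Projective.exists_dual_eq_one k hv
  have hf : ∀ x, f x = g (f x) • v := fun x => by
    obtain ⟨c, hc⟩ := Submodule.mem_span_singleton.1 (h x)
    rw [← hc, map_smul, hg, smul_eq_mul, mul_one]
  have hrank : f = (g ∘ₗ f).smulRight v := LinearMap.ext hf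
  rw [hf v, hrank, LinearMap.trace_smulRight, ← hrank, LinearMap.comp_apply]

theorem finrank_range_comp_of_injective (f : V →ₗ[k] W) {g : W →ₗ[k] X}
    (hg : Function.Injective g) :
    Module.finrank k (LinearMap.range (g ∘ₗ f)) = Module.finrank k (LinearMap.range f) := by
  rw [LinearMap.range_comp, (Submodule.equivMapOfInjective g hg _).finrank_eq]

theorem preimage_isUnit_union_zero_ne_iff {A : Type*} [Ring A] [Module k A] (f : V →ₗ[k] A) :
    f ⁻¹' ({a | IsUnit a} ∪ {0}) ≠ {0} ↔ ∃ t, (IsUnit (f t) ∨ f t = 0) ∧ t ≠ 0 := by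
  have h0 : (0 : V) ∈ f ⁻¹' ({a | IsUnit a} ∪ {0}) := Or.inr (map_zero f)
  rw [← Set.nontrivial_iff_ne_singleton h0, Set.nontrivial_iff_exists_ne h0]
  rfl

end LinearAlgebra

section Character

variable (k : Type v) (A : Type u) [Field k] [Ring A] [Algebra k A]

/-- The character `a ↦ tr(a, M)` of an `A`-module `M`. -/
noncomputable def character (M : Type w) [AddCommGroup M] [Module A M] [Module k M]
    [IsScalarTower k A M] : Module.Dual k A :=
  LinearMap.trace k M ∘ₗ (Algebra.lsmul k k M : A →ₐ[k] Module.End k M).toLinearMap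

variable {A}

section

variable (M : Type w) [AddCommGroup M] [Module A M] [Module k M] [IsScalarTower k A M]

theorem character_apply (a : A) :
    character k A M a = LinearMap.trace k M (Algebra.lsmul k k M a) := rfl

theorem character_mul_comm (a b : A) : character k A M (a * b) = character k A M (b * a) := by
  rw [character_apply, character_apply, map_mul (Algebra.lsmul k k M),
    map_mul (Algebra.lsmul k k M), LinearMap.trace_mul_comm]

variable {M}

theorem character_eq_zero {a : A} (h : ∀ x : M, a • x = 0) : character k A M a = 0 := by
  rw [character_apply, show Algebra.lsmul k k M a = 0 from LinearMap.ext h, map_zero]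

end

theorem character_congr {M N : Type*} [AddCommGroup M] [Module A M] [Module k M]
    [IsScalarTower k A M] [AddCommGroup N] [Module A N] [Module k N] [IsScalarTower k A N]
    (e : M ≃ₗ[A] N) : character k A M = character k A N := by
  ext a
  have hconj : (e.restrictScalars k).conj (Algebra.lsmul k k M a) = Algebra.lsmul k k N a :=
    LinearMap.ext fun x => by simp [LinearEquiv.conj_apply]
  rw [character_apply, character_apply, ← hconj, LinearMap.trace_conj']

theorem character_of_exact {U V W : Type*} [AddCommGroup U] [AddCommGroup V] [AddCommGroup W]
    [Module A U] [Module A V] [Module A W] [Module k U] [Module k V] [Module k W]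
    [IsScalarTower k A U] [IsScalarTower k A V] [IsScalarTower k A W] [Module.Finite k V]
    {f : U →ₗ[A] V} {g : V →ₗ[A] W}
    (hf : Function.Injective f) (hfg : Function.Exact f g) (hg : Function.Surjective g) :
    character k A V = character k A U + character k A W :=
  LinearMap.ext fun a => trace_eq_add_of_exact (f := f.restrictScalars k)
    (g := g.restrictScalars k) hf hfg hg
    (LinearMap.ext fun x => (map_smul f a x).symm) (LinearMap.ext fun x => map_smul g a x)

variable (A) [Module.Finite k A]

open scoped ModuleCat in
/-- The homomorphism `G₀(A) → A^*` given by the characters of modules. -/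
noncomputable def characterHom : G0 A →+ Module.Dual k A :=
  Grothendieck.lift (fun M => character k A M.1) <| by
    rintro ⟨U, hU⟩ ⟨V, hV⟩ ⟨W, hW⟩ f g hf hfg hg
    have := finite_restrict k V
    exact character_of_exact k hf hfg hg

open scoped ModuleCat in
variable {A} in
theorem characterHom_cls (M : ModuleCat.{u} A) (h : Module.Finite A M) {N : Type*}
    [AddCommGroup N] [Module A N] [Module k N] [IsScalarTower k A N] (e : M ≃ₗ[A] N) :
    characterHom k A (Grothendieck.cls M h) = character k A N := by
  rw [characterHom, Grothendieck.lift_cls]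
  exact character_congr k e

/-- The `k`-linear map `G₀(A) ⊗ k → A^*` given by the characters of modules. -/
noncomputable def characterMap : TensorProduct ℤ k (G0 A) →ₗ[k] Module.Dual k A :=
  LinearMap.liftBaseChange k (characterHom k A).toIntLinearMap

theorem characterMap_one_tmul (x : G0 A) : characterMap k A (1 ⊗ₜ x) = characterHom k A x :=
  one_smul k _

end Character

namespace IsProjectiveCover

variable {A P V : Type u} [Ring A] [AddCommGroup P] [AddCommGroup V] [Module A P] [Module A V]
  {π : P →ₗ[A] V}

theorem ker_le_ker (h : IsProjectiveCover π) {W : Type*} [AddCommGroup W] [Module A W]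
    [IsSimpleModule A W] (f : P →ₗ[A] W) : LinearMap.ker π ≤ LinearMap.ker f := by
  rcases eq_or_ne f 0 with rfl | hf
  · rw [LinearMap.ker_zero]
    exact le_top
  have hmax := LinearMap.isCoatom_ker_of_surjective (LinearMap.surjective_of_ne_zero hf)
  by_contra hle
  exact hmax.1 (h.superfluous _ (hmax.not_le_iff_codisjoint.1 hle).eq_top)

theorem exists_comp_eq (h : IsProjectiveCover π) {W : Type*} [AddCommGroup W] [Module A W]
    [IsSimpleModule A W] (f : P →ₗ[A] W) : ∃ φ : V →ₗ[A] W, φ ∘ₗ π = f := by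
  let e := π.quotKerEquivOfSurjective h.surjective
  refine ⟨(LinearMap.ker π).liftQ f (h.ker_le_ker f) ∘ₗ e.symm.toLinearMap,
    LinearMap.ext fun p => ?_⟩
  have hp : e.symm (π p) = (LinearMap.ker π).mkQ p := e.symm_apply_eq.2 rfl
  rw [LinearMap.comp_apply, LinearMap.comp_apply, LinearEquiv.coe_coe, hp]
  rfl

theorem injective [IsSemisimpleModule A P] (h : IsProjectiveCover π) : Function.Injective π := by
  obtain ⟨N, hN⟩ := exists_isCompl (LinearMap.ker π)
  have hNtop : N = ⊤ := h.superfluous N hN.symm.sup_eq_top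
  exact LinearMap.ker_eq_bot.1 (eq_bot_of_isCompl_top (hNtop ▸ hN))

end IsProjectiveCover

section Idempotent

variable {A : Type u} [Ring A]

namespace Irr

/-- The generator of `V = A / m` given by `1`. -/
noncomputable def gen (i : Irr A) : i.V := i.ideal.mkQ 1

theorem gen_ne_zero (i : Irr A) : i.gen ≠ 0 := fun h =>
  Ideal.IsMaximal.ne_top (I := i.ideal) inferInstance <|
    i.ideal.eq_top_iff_one.2 ((Submodule.Quotient.mk_eq_zero _).1 h)

theorem exists_smul_gen (i : Irr A) (x : i.V) : ∃ a : A, a • i.gen = x := by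
  obtain ⟨a, rfl⟩ := i.ideal.mkQ_surjective x
  exact ⟨a, by rw [gen, ← map_smul, smul_eq_mul, mul_one]⟩

theorem mem_jacobson_of_forall_smul_eq_zero {a : A} (h : ∀ (i : Irr A) (x : i.V), a • x = 0) :
    a ∈ Ring.jacobson A := by
  refine Ideal.mem_sInf.2 fun {m : Ideal A} hm => ?_
  have : IsSimpleModule A (A ⧸ m) := isSimpleModule_iff_isCoatom.2 hm
  obtain ⟨i, ⟨e⟩⟩ := exists_equiv (A := A) (A ⧸ m)
  have h1 : a • m.mkQ 1 = 0 := e.injective (by rw [map_smul, h, map_zero])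
  rwa [← map_smul, Submodule.mkQ_apply, Submodule.Quotient.mk_eq_zero, smul_eq_mul, mul_one] at h1

variable [IsArtinianRing A]

/-- A generator of the projective cover `P` of `V`, lifting the generator of `V`. -/
noncomputable def coverGen (i : Irr A) : i.P :=
  Function.surjInv i.isProjectiveCover.surjective i.gen

theorem π_coverGen (i : Irr A) : i.π i.coverGen = i.gen := Function.surjInv_eq _ _

theorem toSpanSingleton_coverGen_surjective (i : Irr A) :
    Function.Surjective (LinearMap.toSpanSingleton A i.P i.coverGen) :=
  i.isProjectiveCover.surjective_of_comp _ fun x => by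
    obtain ⟨a, ha⟩ := i.exists_smul_gen x
    refine ⟨a, ?_⟩
    rw [LinearMap.comp_apply, LinearMap.toSpanSingleton_apply, map_smul, π_coverGen, ha]

theorem exists_incl (i : Irr A) :
    ∃ s : i.P →ₗ[A] A, LinearMap.toSpanSingleton A i.P i.coverGen ∘ₗ s = LinearMap.id :=
  Module.projective_lifting_property _ LinearMap.id i.toSpanSingleton_coverGen_surjective

/-- An embedding `P → A` of the projective cover of `V` as a direct summand of `A`; it splits
the epimorphism `A → P` given by `coverGen`. -/
noncomputable def incl (i : Irr A) : i.P →ₗ[A] A := i.exists_incl.choose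

theorem incl_smul_coverGen (i : Irr A) (p : i.P) : i.incl p • i.coverGen = p :=
  LinearMap.congr_fun i.exists_incl.choose_spec p

/-- A primitive idempotent `e` with `P ≅ A e`. -/
noncomputable def idem (i : Irr A) : A := i.incl i.coverGen

theorem incl_smul (i : Irr A) (a : A) : i.incl (a • i.coverGen) = a * i.idem := map_smul _ _ _

theorem isIdempotentElem_idem (i : Irr A) : IsIdempotentElem i.idem := by
  rw [IsIdempotentElem, ← incl_smul, idem, incl_smul_coverGen]

theorem idem_smul_gen (i : Irr A) : i.idem • i.gen = i.gen := by
  rw [← π_coverGen, ← map_smul, idem, incl_smul_coverGen]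

theorem exists_hom_coverGen_eq (i : Irr A) {M : Type*} [AddCommGroup M] [Module A M] (x : M) :
    ∃ f : i.P →ₗ[A] M, f i.coverGen = i.idem • x :=
  ⟨LinearMap.toSpanSingleton A M x ∘ₗ i.incl, rfl⟩

theorem idem_smul_of_ne {i j : Irr A} (h : i ≠ j) (x : j.V) : i.idem • x = 0 := by
  obtain ⟨f, hf⟩ := i.exists_hom_coverGen_eq x
  by_contra hx
  exact h (eq_of_ne_zero f fun h0 => hx (by rw [← hf, h0, LinearMap.zero_apply]))

theorem span_idem_mul : Ideal.span {x : A | ∃ (i : Irr A) (b : A), x = i.idem * b} = ⊤ := by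
  by_contra h
  obtain ⟨m, hm, hle⟩ := Ideal.exists_le_maximal _ h
  have : IsSimpleModule A (A ⧸ m) := isSimpleModule_iff_isCoatom.2 (Ideal.isMaximal_def.1 hm)
  obtain ⟨i, ⟨e⟩⟩ := exists_equiv (A := A) (A ⧸ m)
  obtain ⟨b, hb⟩ := m.mkQ_surjective (e.symm i.gen)
  have hmem : i.idem * b ∈ m := hle (Ideal.subset_span ⟨i, b, rfl⟩)
  apply i.gen_ne_zero
  rw [← idem_smul_gen, ← e.apply_symm_apply i.gen, ← hb, ← map_smul, ← map_smul, smul_eq_mul,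
    Submodule.mkQ_apply, (Submodule.Quotient.mk_eq_zero _).2 hmem, map_zero]

section Splitting

variable {k : Type v} [Field k] [Algebra k A]

theorem idem_smul_mem_span_gen (hk : IsSplittingFieldFor k A) (i : Irr A) (x : i.V) :
    i.idem • x ∈ Submodule.span k {i.gen} := by
  obtain ⟨f, hf⟩ := i.exists_hom_coverGen_eq x
  obtain ⟨φ, rfl⟩ := i.isProjectiveCover.exists_comp_eq f
  obtain ⟨c, hc⟩ := hk i.V φ
  refine Submodule.mem_span_singleton.2 ⟨c, ?_⟩
  rw [← hf, LinearMap.comp_apply, π_coverGen, hc, algebraMap_smul]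

theorem character_idem_mul_of_ne {i j : Irr A} (h : i ≠ j) (a : A) :
    character k A j.V (i.idem * a) = 0 :=
  character_eq_zero k fun x => by rw [mul_smul, idem_smul_of_ne h]

variable [Module.Finite k A]

theorem idem_smul_smul_gen (hk : IsSplittingFieldFor k A) (i : Irr A) (a : A) :
    i.idem • a • i.gen = character k A i.V (i.idem * a) • i.gen := by
  have : Module.Finite k i.V := Module.Finite.trans A i.V
  rw [← mul_smul]
  refine apply_eq_trace_smul (f := Algebra.lsmul k k i.V (i.idem * a)) fun x => ?_
  have hx : (i.idem * a) • x ∈ Submodule.span k {i.gen} :=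
    mul_smul i.idem a x ▸ idem_smul_mem_span_gen hk i _
  exact hx

theorem character_idem (hk : IsSplittingFieldFor k A) (i : Irr A) :
    character k A i.V i.idem = 1 := by
  have h := idem_smul_smul_gen hk i 1
  rw [one_smul, idem_smul_gen, mul_one] at h
  exact smul_left_injective k i.gen_ne_zero (h.symm.trans (one_smul k _).symm)

theorem idem_mul_mul_idem_sub_mem_jacobson (hk : IsSplittingFieldFor k A) (i : Irr A) (a : A) :
    i.idem * a * i.idem - character k A i.V (i.idem * a) • i.idem ∈ Ring.jacobson A := by
  refine mem_jacobson_of_forall_smul_eq_zero fun j x => ?_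
  rw [sub_smul, smul_assoc, mul_smul, mul_smul, sub_eq_zero]
  rcases eq_or_ne i j with rfl | h
  · obtain ⟨c, hc⟩ := Submodule.mem_span_singleton.1 (idem_smul_mem_span_gen hk i x)
    rw [← hc, smul_comm a, smul_comm i.idem, idem_smul_smul_gen hk, smul_comm c]
  · rw [idem_smul_of_ne h, idem_smul_of_ne h, smul_zero]

end Splitting

end Irr

end Idempotent

section IrreducibleCharacters

variable {k : Type v} {A : Type u} [Field k] [Ring A] [Algebra k A] [Module.Finite k A]

theorem Irr.linearIndependent_character (hk : IsSplittingFieldFor k A) :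
    LinearIndependent k fun i : Irr A => character k A i.V := by
  have : IsArtinianRing A := IsArtinianRing.of_finite k A
  exact .of_pairwise_dual_eq_zero_one _ (fun j => Module.Dual.eval k A j.idem)
    (fun i j h => by simpa using character_idem_mul_of_ne (k := k) h 1)
    fun i => character_idem hk i

theorem Irr.mem_jacobson_of_sum_character_mul_eq_zero [Fintype (Irr A)]
    (hk : IsSplittingFieldFor k A) {c : A}
    (h : ∀ b, ∑ i : Irr A, character k A i.V (b * c) = 0) : c ∈ Ring.jacobson A := by
  have : IsArtinianRing A := IsArtinianRing.of_finite k A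
  refine mem_jacobson_of_forall_smul_eq_zero fun j x => ?_
  by_contra hx
  obtain ⟨d, rfl⟩ := j.exists_smul_gen x
  obtain ⟨b, hb⟩ := IsSimpleModule.toSpanSingleton_surjective A hx j.gen
  have hj : character k A j.V (j.idem * (b * c * d)) = 1 := by
    refine smul_left_injective k j.gen_ne_zero ?_
    change _ • j.gen = (1 : k) • j.gen
    rw [← idem_smul_smul_gen hk, mul_smul, mul_smul, show b • c • d • j.gen = j.gen from hb,
      idem_smul_gen, one_smul]
  have hsum : ∑ i : Irr A, character k A i.V (j.idem * (b * c * d)) = 0 := by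
    rw [← h (d * (j.idem * b))]
    refine Finset.sum_congr rfl fun i _ => ?_
    rw [← mul_assoc, ← mul_assoc, character_mul_comm, mul_assoc d, mul_assoc j.idem]
  rw [Finset.sum_eq_single j (fun i _ hi => character_idem_mul_of_ne hi.symm _)
    fun hj => absurd (Finset.mem_univ j) hj, hj] at hsum
  exact one_ne_zero hsum

end IrreducibleCharacters

section TraceSpace

open FrobeniusForm (can)

variable {k : Type v} {A : Type u} [Field k] [Ring A] [Algebra k A]

theorem can_surjective : Function.Surjective (can (k := k) (A := A)) :=
  (Submodule.mkQ_surjective _).comp Ideal.Quotient.mk_surjective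

theorem can_mul_comm (a b : A) : can (k := k) (a * b) = can (b * a) := by
  rw [← sub_eq_zero, ← map_sub]
  exact (Submodule.Quotient.mk_eq_zero _).2 (Submodule.subset_span
    ⟨Ideal.Quotient.mk _ a, Ideal.Quotient.mk _ b, by simp⟩)

theorem can_eq_zero {a : A} (ha : a ∈ Ring.jacobson A) : can (k := k) a = 0 := by
  have h0 : Ideal.Quotient.mkₐ k (Ring.jacobson A) a = 0 := Ideal.Quotient.eq_zero_iff_mem.2 ha
  rw [can, LinearMap.comp_apply, AlgHom.toLinearMap_apply, h0, map_zero]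

theorem exists_comp_can_eq {M : Type*} [AddCommGroup M] [Module k M] (f : A →ₗ[k] M)
    (hcomm : ∀ a b, f (a * b) = f (b * a)) (hrad : ∀ a ∈ Ring.jacobson A, f a = 0) :
    ∃ g : TraceSpace k (A ⧸ Ring.jacobson A) →ₗ[k] M, g ∘ₗ can = f := by
  let q : (A ⧸ Ring.jacobson A) →ₗ[k] M :=
    ((Ring.jacobson A).restrictScalars k).liftQ f (fun _ ha => LinearMap.mem_ker.2 (hrad _ ha)) ∘ₗ
      (Submodule.Quotient.restrictScalarsEquiv k (Ring.jacobson A)).symm.toLinearMap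
  have hqf (a : A) : q (Ideal.Quotient.mk _ a) = f a := rfl
  have hq : commutatorSubmodule k (A ⧸ Ring.jacobson A) ≤ LinearMap.ker q := by
    rw [commutatorSubmodule, Submodule.span_le]
    rintro _ ⟨x, y, rfl⟩
    obtain ⟨a, rfl⟩ := Ideal.Quotient.mk_surjective x
    obtain ⟨b, rfl⟩ := Ideal.Quotient.mk_surjective y
    rw [SetLike.mem_coe, LinearMap.mem_ker, ← map_mul, ← map_mul, ← map_sub, hqf, map_sub, hcomm,
      sub_self]
  exact ⟨(commutatorSubmodule k (A ⧸ Ring.jacobson A)).liftQ q hq, LinearMap.ext hqf⟩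

theorem exists_comp_can_eq_character (M : Type*) [AddCommGroup M] [Module A M] [Module k M]
    [IsScalarTower k A M] [IsSemisimpleModule A M] :
    ∃ g : Module.Dual k (TraceSpace k (A ⧸ Ring.jacobson A)), g ∘ₗ can = character k A M :=
  exists_comp_can_eq _ (character_mul_comm k M) fun _ ha => character_eq_zero k fun x =>
    Module.mem_annihilator.1 (IsSemisimpleModule.jacobson_le_annihilator A M ha) x

variable [Module.Finite k A] [IsArtinianRing A]

theorem linearIndependent_can_idem (hk : IsSplittingFieldFor k A) :
    LinearIndependent k fun i : Irr A => can (k := k) i.idem := by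
  choose g hg using fun i : Irr A => exists_comp_can_eq_character (k := k) (A := A) i.V
  have hgc : ∀ (i : Irr A) (a : A), g i (can a) = character k A i.V a :=
    fun i => LinearMap.congr_fun (hg i)
  refine .of_pairwise_dual_eq_zero_one _ g (fun i j h => ?_) fun i => ?_
  · simpa [hgc] using Irr.character_idem_mul_of_ne (k := k) h.symm 1
  · rw [hgc, Irr.character_idem hk]

theorem can_mul_idem_mul (hk : IsSplittingFieldFor k A) (i : Irr A) (a b : A) :
    can (k := k) (a * i.idem * b) = character k A i.V (i.idem * (b * a)) • can i.idem := by
  have hidem := i.isIdempotentElem_idem.eq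
  calc can (k := k) (a * i.idem * b)
      = can (i.idem * (i.idem * (b * a))) := by
        rw [mul_assoc, can_mul_comm, ← mul_assoc i.idem, hidem, mul_assoc]
    _ = can (i.idem * (b * a) * i.idem) := can_mul_comm ..
    _ = character k A i.V (i.idem * (b * a)) • can i.idem := by
        rw [← map_smul, ← sub_eq_zero, ← map_sub]
        exact can_eq_zero (Irr.idem_mul_mul_idem_sub_mem_jacobson hk i (b * a))

theorem span_can_idem (hk : IsSplittingFieldFor k A) :
    ⊤ ≤ Submodule.span k (Set.range fun i : Irr A => can (k := k) i.idem) := by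
  rintro t -
  obtain ⟨a, rfl⟩ := can_surjective t
  have ha : a ∈ Ideal.span {x : A | ∃ (i : Irr A) (b : A), x = i.idem * b} :=
    by
    rw [Irr.span_idem_mul]; exact Submodule.mem_top
  induction ha using Submodule.closure_induction with
  | zero => rw [map_zero]; exact zero_mem _
  | add x y _ _ hx hy => rw [map_add]; exact add_mem hx hy
  | smul_mem a x hx =>
    obtain ⟨i, b, rfl⟩ := hx
    rw [smul_eq_mul, ← mul_assoc, can_mul_idem_mul hk]
    exact Submodule.smul_mem _ _ (Submodule.subset_span ⟨i, rfl⟩)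

/-- The basis of `T(A / rad A)` given by the primitive idempotents `e` with `P ≅ A e`. -/
noncomputable def traceBasis (hk : IsSplittingFieldFor k A) :
    Module.Basis (Irr A) k (TraceSpace k (A ⧸ Ring.jacobson A)) :=
  .mk (linearIndependent_can_idem hk) (span_can_idem hk)

/-- The isomorphism `K₀(A) ⊗ k ≃ T(A / rad A)` given by the Hattori–Stallings rank, which sends
`[A e]` to the class of the idempotent `e`. It is encoded by its values on the basis `[P]`. -/
noncomputable def hattoriStallings (hk : IsSplittingFieldFor k A) :
    TensorProduct ℤ k (K0 A) ≃ₗ[k] TraceSpace k (A ⧸ Ring.jacobson A) :=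
  (Algebra.TensorProduct.basis k (projBasis k A)).equiv (traceBasis hk) (Equiv.refl _)

theorem hattoriStallings_one_tmul_projClass (hk : IsSplittingFieldFor k A) (i : Irr A) :
    hattoriStallings hk (1 ⊗ₜ projClass i) = can i.idem := by
  have h := (Algebra.TensorProduct.basis k (projBasis k A)).equiv_apply (b' := traceBasis hk) i
    (Equiv.refl _)
  rwa [Algebra.TensorProduct.basis_apply, projBasis, Module.Basis.mk_apply, traceBasis,
    Module.Basis.mk_apply] at h

end TraceSpace

section CharacterMap

variable {k : Type v} {A : Type u} [Field k] [Ring A] [Algebra k A] [Module.Finite k A]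

theorem characterHom_irrClass (i : Irr A) :
    characterHom k A (irrClass i) = character k A i.V :=
  characterHom_cls k _ _ (LinearEquiv.refl A _)

theorem characterMap_injective (hk : IsSplittingFieldFor k A) :
    Function.Injective (characterMap k A) := by
  have : IsArtinianRing A := IsArtinianRing.of_finite k A
  let b := Algebra.TensorProduct.basis k (irrBasis k A)
  have hconstr : characterMap k A = b.constr k fun i => character k A i.V := b.ext fun i => by
    rw [b.constr_basis, Algebra.TensorProduct.basis_apply, characterMap_one_tmul, irrBasis,
      Module.Basis.mk_apply, characterHom_irrClass]
  rw [hconstr]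
  exact b.injective_constr_of_linearIndependent (Irr.linearIndependent_character hk)

theorem baseChange_cartanMap_injective (hdet : (cartanDet k A : k) ≠ 0) :
    Function.Injective ((cartanMap A).baseChange k) := by
  have : IsArtinianRing A := IsArtinianRing.of_finite k A
  let _ := @Fintype.ofFinite (Irr A) (finite_irr k A)
  have hunit : IsUnit (LinearMap.toMatrix (Algebra.TensorProduct.basis k (projBasis k A))
      (Algebra.TensorProduct.basis k (irrBasis k A)) ((cartanMap A).baseChange k)).det := by
    rw [LinearMap.toMatrix_baseChange, algebraMap_int_eq, ← RingHom.mapMatrix_apply,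
      ← RingHom.map_det]
    exact hdet.isUnit
  exact (LinearEquiv.ofIsUnitDet hunit).injective

variable [IsArtinianRing A]

theorem cartanMap_projClass (i : Irr A) :
    cartanMap A (projClass i) =
      Grothendieck.cls (.of A i.P) (inferInstanceAs (Module.Finite A i.P)) := by
  rw [cartanMap, AddMonoidHom.coe_toIntLinearMap, projClass, Grothendieck.map_cls]

theorem characterHom_cartanMap_projClass (i : Irr A) :
    characterHom k A (cartanMap A (projClass i)) = character k A i.P := by
  rw [cartanMap_projClass]
  exact characterHom_cls k _ _ (LinearEquiv.refl A _)

end CharacterMap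

namespace FrobeniusForm

variable {k : Type v} {A : Type u} [Field k] [Ring A] [Algebra k A] (β : FrobeniusForm k A)

theorem flip_form_injective : Function.Injective (LinearMap.flip β.form) :=
  (injective_iff_map_eq_zero _).2 fun a ha => β.nondegenerate.2 a (LinearMap.congr_fun ha)

variable [Module.Finite k A]

theorem mul_higmanTrace_eq_zero {b : A} (hb : b ∈ Ring.jacobson A) (a : A) :
    b * β.higmanTrace a = 0 := by
  have : IsArtinianRing A := IsArtinianRing.of_finite k A
  obtain ⟨n, hn⟩ := (inferInstance : IsSemiprimaryRing A).isNilpotent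
  refine β.nondegenerate.2 _ fun c => ?_
  have hcb : (c * b) ^ n = 0 := by
    have hmem := Ideal.pow_mem_pow (Ideal.mul_mem_left _ c hb) n
    rwa [hn] at hmem
  have hnil : IsNilpotent (LinearMap.mulLeft k (c * b) * LinearMap.mulRight k a) := by
    refine (LinearMap.commute_mulLeft_right (c * b) a).isNilpotent_mul_right ⟨n, ?_⟩
    rw [LinearMap.pow_mulLeft, hcb, LinearMap.mulLeft_zero_eq_zero]
  rw [← β.assoc, form_higmanTrace]
  exact (LinearMap.isNilpotent_trace_of_isNilpotent hnil).eq_zero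

theorem isSemisimpleRing_of_isUnit_higmanTrace {a : A} (ha : IsUnit (β.higmanTrace a)) :
    IsSemisimpleRing A := by
  have : IsArtinianRing A := IsArtinianRing.of_finite k A
  rw [IsArtinianRing.isSemisimpleRing_iff_jacobson, eq_bot_iff]
  exact fun b hb => ha.mul_left_eq_zero.1 (β.mul_higmanTrace_eq_zero hb a)

theorem range_higmanTraceTilde :
    LinearMap.range β.higmanTraceTilde = LinearMap.range β.higmanTrace :=
  (LinearMap.range_comp_of_range_eq_top β.higmanTraceTilde
    (LinearMap.range_eq_top.2 can_surjective)).symm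

theorem flip_form_higmanTrace_idem [IsArtinianRing A] (i : Irr A) :
    (LinearMap.flip β.form) (β.higmanTrace i.idem) = character k A i.P := by
  have : Module.Finite k i.P := Module.Finite.trans A i.P
  let p : A →ₗ[k] i.P := (LinearMap.toSpanSingleton A i.P i.coverGen).restrictScalars k
  ext b
  have hfactor : LinearMap.mulLeft k b * LinearMap.mulRight k i.idem =
      (i.incl.restrictScalars k ∘ₗ Algebra.lsmul k k i.P b) ∘ₗ p := by
    ext x
    change b * (x * i.idem) = i.incl (b • x • i.coverGen)
    rw [map_smul, Irr.incl_smul, smul_eq_mul]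
  have hsplit : p ∘ₗ i.incl.restrictScalars k ∘ₗ Algebra.lsmul k k i.P b =
      Algebra.lsmul k k i.P b :=
    LinearMap.ext fun _ => i.incl_smul_coverGen _
  rw [LinearMap.flip_apply, form_higmanTrace, character_apply, hfactor,
    LinearMap.trace_comp_comm', hsplit]

theorem flip_form_comp_higmanTraceTilde_comp_hattoriStallings [IsArtinianRing A]
    (hk : IsSplittingFieldFor k A) :
    LinearMap.flip β.form ∘ₗ β.higmanTraceTilde ∘ₗ (hattoriStallings hk).toLinearMap =
      characterMap k A ∘ₗ (cartanMap A).baseChange k := by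
  refine (Algebra.TensorProduct.basis k (projBasis k A)).ext fun i => ?_
  rw [Algebra.TensorProduct.basis_apply, projBasis, Module.Basis.mk_apply]
  simp only [LinearMap.comp_apply, LinearEquiv.coe_coe]
  rw [hattoriStallings_one_tmul_projClass, higmanTraceTilde_can, flip_form_higmanTrace_idem,
    LinearMap.baseChange_tmul, characterMap_one_tmul, characterHom_cartanMap_projClass]

theorem finrank_range_cartanMap (hk : IsSplittingFieldFor k A) :
    Module.finrank k (LinearMap.range ((cartanMap A).baseChange k)) =
      Module.finrank k (LinearMap.range β.higmanTrace) := by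
  have : IsArtinianRing A := IsArtinianRing.of_finite k A
  rw [← finrank_range_comp_of_injective _ (characterMap_injective hk),
    ← β.flip_form_comp_higmanTraceTilde_comp_hattoriStallings hk,
    finrank_range_comp_of_injective _ β.flip_form_injective,
    LinearMap.range_comp_of_range_eq_top _ (hattoriStallings hk).range, range_higmanTraceTilde]

theorem higmanTraceTilde_injective (hk : IsSplittingFieldFor k A)
    (hdet : (cartanDet k A : k) ≠ 0) : Function.Injective β.higmanTraceTilde := by
  have : IsArtinianRing A := IsArtinianRing.of_finite k A
  have hinj := (characterMap_injective hk).comp (baseChange_cartanMap_injective hdet)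
  rw [← LinearMap.coe_comp, ← β.flip_form_comp_higmanTraceTilde_comp_hattoriStallings hk,
    LinearMap.coe_comp, LinearMap.coe_comp] at hinj
  exact hinj.of_comp.of_comp_right (hattoriStallings hk).surjective

end FrobeniusForm

namespace Grothendieck

variable {A : Type u} [Ring A] {C : ModuleCat.{u} A → Prop}

theorem cls_eq_zero_of_subsingleton (M : ModuleCat.{u} A) (hM : C M) [Subsingleton M] :
    cls M hM = 0 :=
  left_eq_add.1 <| cls_eq_add hM hM hM (0 : M →ₗ[A] M) (0 : M →ₗ[A] M)
    (Function.injective_of_subsingleton _) (fun x => by simp [Subsingleton.elim x 0])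
    (fun x => ⟨0, Subsingleton.elim _ _⟩)

theorem cls_eq_of_equiv {M N : ModuleCat.{u} A} (hM : C M) (hN : C N)
    (hZ : C (.of A PUnit.{u + 1})) (e : M ≃ₗ[A] N) : cls M hM = cls N hN := by
  rw [cls_eq_add hZ hM hN (0 : PUnit.{u + 1} →ₗ[A] M) e.toLinearMap
    (Function.injective_of_subsingleton _) (LinearMap.exact_zero_iff_injective _ _ |>.2 e.injective)
    e.surjective, cls_eq_zero_of_subsingleton, zero_add]

end Grothendieck

section Semisimple

variable {k : Type v} {A : Type u} [Field k] [Ring A] [Algebra k A]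

/-- For semisimple `A`, the isomorphism `P ≃ V` given by the projective cover of `V`. -/
noncomputable def Irr.equivV [IsSemisimpleRing A] (i : Irr A) :
    i.P ≃ₗ[A] i.V :=
  .ofBijective i.π ⟨i.isProjectiveCover.injective, i.isProjectiveCover.surjective⟩

theorem cartanMap_projClass_eq_irrClass [IsSemisimpleRing A] (i : Irr A) :
    cartanMap A (projClass i) = irrClass i := by
  rw [cartanMap_projClass]
  exact Grothendieck.cls_eq_of_equiv _ _ (inferInstanceAs (Module.Finite A PUnit.{u + 1})) i.equivV

variable [Module.Finite k A]

theorem cartanMatrix_eq_one [IsSemisimpleRing A] : cartanMatrix k A = 1 := by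
  let _ := @Fintype.ofFinite (Irr A) (finite_irr k A)
  ext i j
  have h : cartanMap A (projBasis k A j) = irrBasis k A j := by
    rw [projBasis, irrBasis, Module.Basis.mk_apply, Module.Basis.mk_apply,
      cartanMap_projClass_eq_irrClass]
  rw [cartanMatrix, LinearMap.toMatrix_apply, h, Module.Basis.repr_self,
    Finsupp.single_eq_pi_single, Pi.single_comm,
    Matrix.one_eq_pi_single]

theorem FrobeniusForm.isUnit_higmanTrace_sum_idem [IsSemisimpleRing A]
    [Fintype (Irr A)] (hk : IsSplittingFieldFor k A) (β : FrobeniusForm k A) :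
    IsUnit (β.higmanTrace (∑ i : Irr A, i.idem)) := by
  set t := β.higmanTrace (∑ i : Irr A, i.idem) with ht
  have hform (b : A) : β.form b t = ∑ i : Irr A, character k A i.V b := by
    rw [ht, map_sum, map_sum]
    refine Finset.sum_congr rfl fun i _ => ?_
    rw [← LinearMap.flip_apply, flip_form_higmanTrace_idem, character_congr k i.equivV]
  rw [IsArtinianRing.isUnit_iff_isRightRegular, isRightRegular_iff_left_eq_zero_of_mul]
  intro c hc
  have hmem : c ∈ Ring.jacobson A :=
    Irr.mem_jacobson_of_sum_character_mul_eq_zero hk fun b => by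
      rw [← hform, β.assoc, hc, map_zero]
  rwa [IsSemisimpleRing.jacobson_eq_bot] at hmem

end Semisimple

end FrobeniusCartan

open FrobeniusCartan in
theorem theorem2p6 {k A : Type*} [Field k] [Ring A] [Algebra k A] [Module.Finite k A]
    (hk : IsSplittingFieldFor k A) (β : FrobeniusForm k A) :
    Module.finrank k (LinearMap.range ((cartanMap A).baseChange k)) =
      Module.finrank k (LinearMap.range β.higmanTrace) ∧
    (Nontrivial A →
      List.TFAE [
        IsSemisimpleRing A,
        cartanMatrix k A = 1 ∧ β.higmanTraceTilde ⁻¹' ({a | IsUnit a} ∪ {0}) ≠ {0},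
        ¬ (ringChar k : ℤ) ∣ cartanDet k A ∧
          β.higmanTraceTilde ⁻¹' ({a | IsUnit a} ∪ {0}) ≠ {0}]) := by
  have : IsArtinianRing A := IsArtinianRing.of_finite k A
  let _ := @Fintype.ofFinite (Irr A) (finite_irr k A)
  refine ⟨β.finrank_range_cartanMap hk, fun _ => ?_⟩
  rw [preimage_isUnit_union_zero_ne_iff, ← CharP.intCast_eq_zero_iff k (ringChar k)]
  tfae_have 1 → 2 := fun _ => by
    have hunit := β.isUnit_higmanTrace_sum_idem hk
    refine ⟨cartanMatrix_eq_one, FrobeniusForm.can (∑ i : Irr A, i.idem), .inl hunit, fun h0 => ?_⟩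
    rw [← β.higmanTraceTilde_can, h0, map_zero] at hunit
    exact not_isUnit_zero hunit
  tfae_have 2 → 3 := fun ⟨hC, hτ⟩ =>
    ⟨by rw [cartanDet, hC, Matrix.det_one, Int.cast_one]; exact one_ne_zero, hτ⟩
  tfae_have 3 → 1 := by
    rintro ⟨hdet, t, hunit | hzero, ht⟩
    · obtain ⟨a, rfl⟩ := can_surjective t
      exact β.isSemisimpleRing_of_isUnit_higmanTrace hunit
    · exact absurd (β.higmanTraceTilde_injective hk hdet (hzero.trans (map_zero _).symm)) ht
  tfae_finish
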